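/- For a group $G$, a $G$-automaton is a nondeterministic finite automaton with $\varepsilon$-moves (finite state set $Q$, finite input alphabet $\Sigma$, one initial state, a set of accepting states) equipped with a register that holds an element of $G$, initially the identity. Its transition function $\delta$ assigns to each pair in $Q\times(\Sigma\cup\{\varepsilon\})$ a finite subset of $Q\times G$; using $(q',m)\in\delta(q,\sigma)$, the automaton in state $q$ reads $\sigma$, moves to $q'$ and replaces the register content $x$ by $xm$. A word is accepted if some computation reads it completely and ends in an accepting state with the identity of $G$ in the register. Let $\mathfrak{L}(G)$ be the class of languages over finite alphabets recognized by $G$-automata, let $\mathbb{Q}^+$ be the multiplicative group of positive rationals, and let $SL(2,\mathbb{Q})$ be the group of $2\times 2$ rational matrices of determinant $1$. **Theorem.** $\mathfrak{L}(\mathbb{Q}^+)\subsetneq\mathfrak{L}(SL(2,\mathbb{Q}))$. More precisely: 1. The map $\varphi:\mathbb{Q}^+\to SL(2,\mathbb{Q})$, $\varphi(s)=\begin{pmatrix}s&0\\0&1/s\end{pmatrix}$, is an injective homomorphism, and replacing each register label $s$ of a $\mathbb{Q}^+$-automaton by $\varphi(s)$ gives an $SL(2,\mathbb{Q})$-automaton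 recognizing the same language. 2. Every language in $\mathfrak{L}(\mathbb{Q}^+)$ over a one-letter alphabet is regular. 3. The language $\{a^{2^{2n+1}}\mid n\ge 0\}$ over the alphabet $\{a\}$ belongs to $\mathfrak{L}(SL(2,\mathbb{Q}))$ and is not regular. -/

import Mathlib

/-- An extended finite automaton over a group `G` (a `G`-automaton) with input alphabet `α` and
state set `σ`.  `(q', m) ∈ step q (some a)` means that in state `q`, reading the symbol `a`, the
automaton may move to state `q'` and multiply its register by `m` on the right;
`(q', m) ∈ step q none` is the same without reading a symbol.  The automaton is finitely
described: every set of possible moves is finite (finiteness of `α` and `σ` is required where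
languages are classified). -/
structure GroupAutomaton (G : Type) [Group G] (α σ : Type) where
  /-- The transition function. -/
  step : σ → Option α → Set (σ × G)
  finite_step : ∀ q a, (step q a).Finite
  /-- The initial state. -/
  start : σ
  /-- The set of accepting states. -/
  accept : Set σ

namespace GroupAutomaton

/-- A configuration: current state, input still to be read, content of the register. -/
structure Config (G α σ : Type) where
  state : σ
  input : List α
  register : G

/-- One move of a `G`-automaton. -/
inductive Move {G : Type} [Group G] {α σ : Type} (E : GroupAutomaton G α σ) :
    Config G α σ → Config G α σ → Prop
  | read (q q' : σ) (a : α) (w : List α) (x m : G) (h : (q', m) ∈ E.step q (some a)) :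
      Move E ⟨q, a :: w, x⟩ ⟨q', w, x * m⟩
  | silent (q q' : σ) (w : List α) (x m : G) (h : (q', m) ∈ E.step q none) :
      Move E ⟨q, w, x⟩ ⟨q', w, x * m⟩

/-- The language recognized by a `G`-automaton: the words `w` such that some computation that
starts in the initial state with the neutral element in the register reads `w` completely and ends
in an accepting state with the neutral element in the register. -/
def language {G : Type} [Group G] {α σ : Type} (E : GroupAutomaton G α σ) : Language α :=
  {w | ∃ q ∈ E.accept, Relation.ReflTransGen E.Move ⟨E.start, w, 1⟩ ⟨q, [], 1⟩}

/-- The automaton obtained by replacing each group element `m` in the transitions by `φ m`. -/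
def mapLabels {G H : Type} [Group G] [Group H] {α σ : Type} (φ : G →* H)
    (E : GroupAutomaton G α σ) : GroupAutomaton H α σ where
  step q a := (fun p : σ × G => (p.1, φ p.2)) '' E.step q a
  finite_step q a := (E.finite_step q a).image _
  start := E.start
  accept := E.accept

end GroupAutomaton

/-- A formal language together with its finite alphabet. -/
structure FormalLanguage where
  alphabet : Type
  finite_alphabet : Finite alphabet
  words : Language alphabet

/-- The class `𝔏(G)` of the languages, over arbitrary finite alphabets, that are recognized by
`G`-automata with finitely many states. -/
def languageClass (G : Type) [Group G] : Set FormalLanguage :=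
  {L | ∃ (σ : Type) (_ : Finite σ) (E : GroupAutomaton G L.alphabet σ), E.language = L.words}

/-- The multiplicative group `ℚ⁺` of positive rational numbers. -/
abbrev PosRat : Type := {q : ℚ // 0 < q}

/-- The matrix `diag(s, 1/s)`, as an element of `SL(2, ℚ)`. -/
def diagSL (s : PosRat) : Matrix.SpecialLinearGroup (Fin 2) ℚ :=
  ⟨!![(s : ℚ), 0; 0, 1 / (s : ℚ)], by
    have h : (s : ℚ) ≠ 0 := s.2.ne'
    simp [Matrix.det_fin_two, h]⟩

theorem coe_diagSL (s : PosRat) :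
    (diagSL s : Matrix (Fin 2) (Fin 2) ℚ) = !![(s : ℚ), 0; 0, 1 / (s : ℚ)] := rfl

/-- The homomorphism `s ↦ diag(s, 1/s)` from `ℚ⁺` to `SL(2, ℚ)`. -/
def diagHom : PosRat →* Matrix.SpecialLinearGroup (Fin 2) ℚ where
  toFun := diagSL
  map_one' := by
    ext i j
    fin_cases i <;> fin_cases j <;> simp [coe_diagSL]
  map_mul' s t := by
    ext i j
    rw [Matrix.SpecialLinearGroup.coe_mul, coe_diagSL, coe_diagSL, coe_diagSL]
    fin_cases i <;> fin_cases j <;> simp [mul_comm]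

/-- The unary language `{a ^ (2 ^ (2n+1)) | n ≥ 0}` over the alphabet `{a}`, where the letter `a`
is `() : Unit`. -/
def oddPowLanguage : FormalLanguage where
  alphabet := Unit
  finite_alphabet := inferInstance
  words := {w | ∃ n : ℕ, w = List.replicate (2 ^ (2 * n + 1)) ()}

/-! An injective homomorphism of registers preserves and reflects the final identity test, so
relabelling along it keeps the language; this gives the inclusion. It is strict because of unary
languages. Over a commutative group a computation matters only through its total in `ℕ × G` (letters
read, register factor), and Kleene's recursion makes the set of totals semilinear
(`PathLabel.isSemilinearSet`). Its slice at the identity register is a semilinear, hence ultimately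
periodic, set of lengths, so the language is regular. In `SL(2, ℚ)`, conjugating a shear by `diagTwo
^ n` multiplies its off-diagonal entry by `4 ^ n` (`diagTwo_conj_shearSL_eq_one_iff`), so a unary
automaton can test for length `2 * 4 ^ n`, which grows too fast for regularity. -/

/-! ### Semilinearity of path labels in finite graphs -/

section PathLabels

open AddSubmonoid Pointwise

/-- `PathLabel T S p q m`: there is a nonempty path from `p` to `q` whose intermediate vertices lie
in `S` and whose edge labels, taken from the sets `T`, add up to `m`. -/
inductive PathLabel {M σ : Type*} [AddCommMonoid M] (T : σ → σ → Set M) (S : Set σ) :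
    σ → σ → M → Prop
  | single {p q : σ} {m : M} (h : m ∈ T p q) : PathLabel T S p q m
  | cons {p r q : σ} {m m' : M} (h : m ∈ T p r) (hr : r ∈ S) (h' : PathLabel T S r q m') :
      PathLabel T S p q (m + m')

namespace PathLabel

variable {M σ : Type*} [AddCommMonoid M] {T : σ → σ → Set M} {S S' : Set σ} {p q r : σ} {m m' : M}

theorem mono (hS : S ⊆ S') (h : PathLabel T S p q m) : PathLabel T S' p q m := by
  induction h with
  | single h => exact single h
  | cons h hr _ ih => exact cons h (hS hr) ih

theorem trans (h : PathLabel T S p r m) (hr : r ∈ S) (h' : PathLabel T S r q m') :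
    PathLabel T S p q (m + m') := by
  induction h with
  | single h => exact cons h hr h'
  | cons h hs _ ih => rw [add_assoc]; exact cons h hs (ih hr h')

theorem add_mem_closure (h : PathLabel T S p r m) (hr : r ∈ S)
    (hm' : m' ∈ closure {b | PathLabel T S r r b}) : PathLabel T S p r (m + m') := by
  induction hm' using closure_induction generalizing m with
  | mem b hb => exact h.trans hr hb
  | zero => rwa [add_zero]
  | add a b _ _ iha ihb => rw [← add_assoc]; exact ihb (iha h)

theorem setOf_empty (T : σ → σ → Set M) (p q : σ) : {m | PathLabel T ∅ p q m} = T p q := by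
  ext m
  refine ⟨fun h => ?_, single⟩
  cases h with
  | single h => exact h
  | cons _ hr _ => exact hr.elim

/-- Kleene's recursion. -/
theorem setOf_insert (T : σ → σ → Set M) (S : Set σ) (r p q : σ) :
    {m | PathLabel T (insert r S) p q m} = {m | PathLabel T S p q m} ∪
      ({m | PathLabel T S p r m} + (closure {m | PathLabel T S r r m} : Set M) +
        {m | PathLabel T S r q m}) := by
  ext m
  constructor
  · intro h
    change PathLabel T (insert r S) p q m at h
    induction h with
    | single h => exact Or.inl (single h)
    | @cons p s q m m' h hs _ ih =>
      rcases eq_or_ne s r with rfl | hsr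
      -- The first edge ends at `r`: it is now the initial segment, and the former initial segment
      -- `a`, if any, becomes one more loop at `r`.
      · right
        rcases ih with ih | ⟨_, ⟨a, ha, b, hb, rfl⟩, c, hc, rfl⟩
        · exact ⟨_, ⟨m, single h, 0, zero_mem _, rfl⟩, m', ih, by simp⟩
        · exact ⟨_, ⟨m, single h, a + b, add_mem (subset_closure ha) hb, rfl⟩, c, hc,
            by simp [add_assoc]⟩
      · have hs : s ∈ S := hs.resolve_left hsr
        rcases ih with ih | ⟨_, ⟨a, ha, b, hb, rfl⟩, c, hc, rfl⟩
        · exact Or.inl (cons h hs ih)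
        · exact Or.inr ⟨_, ⟨m + a, cons h hs ha, b, hb, rfl⟩, c, hc, by simp [add_assoc]⟩
  · have hsub : S ⊆ insert r S := Set.subset_insert r S
    rintro (h | ⟨_, ⟨a, ha, b, hb, rfl⟩, c, hc, rfl⟩)
    · exact mono hsub h
    · refine trans (add_mem_closure (mono hsub ha) (Set.mem_insert r S) ?_)
        (Set.mem_insert r S) (mono hsub hc)
      exact closure_mono (fun _ hx => mono hsub hx) hb

/-- Parikh's theorem for finite graphs labelled in a commutative monoid. -/
theorem isSemilinearSet [Finite σ] (hT : ∀ p q, IsSemilinearSet (T p q)) (S : Set σ) (p q : σ) :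
    IsSemilinearSet {m | PathLabel T S p q m} := by
  induction S, S.toFinite using Set.Finite.induction_on generalizing p q with
  | empty => rw [setOf_empty]; exact hT p q
  | insert _ _ ih =>
    rw [setOf_insert]
    exact (ih p q).union (((ih _ _).add (ih _ _).closure).add (ih _ _))

end PathLabel

end PathLabels

/-! ### Unary automata over commutative groups -/

namespace GroupAutomaton

section Unary

variable {G : Type} [CommGroup G] {α σ : Type}

/-- The labels of the moves from `p` to `q`: number of letters read, and factor of the register. -/
def moveLabels (E : GroupAutomaton G α σ) (p q : σ) : Set (ℕ × Additive G) :=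
  ⋃ o : Option α, (fun t : σ × G => (o.toList.length, Additive.ofMul t.2)) ''
    {t ∈ E.step p o | t.1 = q}

theorem mem_moveLabels {E : GroupAutomaton G α σ} {p q : σ} {m : ℕ × Additive G} :
    m ∈ E.moveLabels p q ↔
      ∃ o : Option α, ∃ g, (q, g) ∈ E.step p o ∧ m = (o.toList.length, Additive.ofMul g) := by
  simp only [moveLabels, Set.mem_iUnion]
  refine exists_congr fun o => ⟨?_, ?_⟩
  · rintro ⟨⟨q', g⟩, ⟨h, rfl⟩, rfl⟩
    exact ⟨g, h, rfl⟩
  · rintro ⟨g, h, rfl⟩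
    exact ⟨(q, g), ⟨h, rfl⟩, rfl⟩

theorem isSemilinearSet_moveLabels [Finite α] (E : GroupAutomaton G α σ) (p q : σ) :
    IsSemilinearSet (E.moveLabels p q) :=
  .of_finite (Set.finite_iUnion fun o => ((E.finite_step p o).sep _).image _)

/-- With at most one letter, the next letter always matches the one the move reads, so only the
remaining length matters. -/
theorem move_of_mem_moveLabels [Subsingleton α] {E : GroupAutomaton G α σ} {p q : σ}
    {m : ℕ × Additive G} (h : m ∈ E.moveLabels p q) (w : List α) (hw : m.1 ≤ w.length) (x : G) :
    E.Move ⟨p, w, x⟩ ⟨q, w.drop m.1, x * m.2.toMul⟩ := by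
  obtain ⟨_ | a, g, hg, rfl⟩ := mem_moveLabels.1 h
  · exact .silent _ _ _ _ _ hg
  · rcases w with _ | ⟨b, w⟩
    · simp at hw
    · obtain rfl := Subsingleton.elim a b
      exact .read _ _ _ _ _ _ hg

theorem reflTransGen_of_pathLabel [Subsingleton α] {E : GroupAutomaton G α σ} {p q : σ}
    {m : ℕ × Additive G} (h : PathLabel E.moveLabels Set.univ p q m) (w : List α)
    (hw : w.length = m.1) (x : G) :
    Relation.ReflTransGen E.Move ⟨p, w, x⟩ ⟨q, [], x * m.2.toMul⟩ := by
  induction h generalizing w x with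
  | single h =>
    have := move_of_mem_moveLabels h w hw.ge x
    rw [List.drop_of_length_le hw.le] at this
    exact .single this
  | @cons p r q m m' h _ _ ih =>
    rw [Prod.fst_add] at hw
    refine .head (move_of_mem_moveLabels h w (by omega) x) ?_
    have := ih (w.drop m.1) (by rw [List.length_drop]; omega) (x * m.2.toMul)
    rwa [mul_assoc, ← toMul_add, ← Prod.snd_add] at this

theorem Move.mem_moveLabels {E : GroupAutomaton G α σ} {c d : Config G α σ} (h : E.Move c d) :
    ∃ m ∈ E.moveLabels c.state d.state, c.input.length = m.1 + d.input.length ∧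
      d.register = c.register * m.2.toMul := by
  cases h with
  | read q q' a w x m h =>
    exact ⟨_, GroupAutomaton.mem_moveLabels.2 ⟨some a, m, h, rfl⟩, by simp [add_comm], rfl⟩
  | silent q q' w x m h =>
    exact ⟨_, GroupAutomaton.mem_moveLabels.2 ⟨none, m, h, rfl⟩, by simp, rfl⟩

theorem eq_or_pathLabel_of_reflTransGen {E : GroupAutomaton G α σ} {c d : Config G α σ}
    (h : Relation.ReflTransGen E.Move c d) :
    c = d ∨ ∃ m, PathLabel E.moveLabels Set.univ c.state d.state m ∧
      c.input.length = m.1 + d.input.length ∧ d.register = c.register * m.2.toMul := by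
  induction h using Relation.ReflTransGen.head_induction_on with
  | refl => exact .inl rfl
  | head h _ ih =>
    right
    obtain ⟨m, hm, hl, hr⟩ := h.mem_moveLabels
    rcases ih with rfl | ⟨m', hm', hl', hr'⟩
    · exact ⟨m, .single hm, hl, hr⟩
    · refine ⟨m + m', .cons hm trivial hm', ?_, ?_⟩
      · rw [Prod.fst_add]; omega
      · rw [hr', hr, Prod.snd_add, toMul_add, mul_assoc]

/-- `PathLabel` describes nonempty paths only, so the computation with no moves is a separate case.
-/
theorem mem_language_iff_pathLabel [Subsingleton α] (E : GroupAutomaton G α σ) (w : List α) :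
    w ∈ E.language ↔ (E.start ∈ E.accept ∧ w.length = 0) ∨
      ∃ q ∈ E.accept, PathLabel E.moveLabels Set.univ E.start q (w.length, 0) := by
  constructor
  · rintro ⟨q, hq, h⟩
    rcases eq_or_pathLabel_of_reflTransGen h with h | ⟨⟨n, g⟩, hm, hl, hr⟩
    · injection h with h₁ h₂ h₃
      exact .inl ⟨h₁ ▸ hq, by simp [h₂]⟩
    · obtain rfl : w.length = n := by simpa using hl
      obtain rfl : g = 0 := by simpa using hr.symm
      exact .inr ⟨q, hq, hm⟩
  · rintro (⟨hs, hw⟩ | ⟨q, hq, h⟩)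
    · obtain rfl := List.length_eq_zero_iff.1 hw
      exact ⟨_, hs, .refl⟩
    · have := reflTransGen_of_pathLabel h w rfl 1
      rw [toMul_zero, mul_one] at this
      exact ⟨q, hq, this⟩

/-- The lengths of the words of a unary language recognized by an automaton over a commutative
group form a semilinear set. -/
theorem exists_isSemilinearSet_length [Finite α] [Finite σ] [Subsingleton α]
    (E : GroupAutomaton G α σ) :
    ∃ A : Set ℕ, IsSemilinearSet A ∧ ∀ w, w ∈ E.language ↔ w.length ∈ A := by
  let R : Set (ℕ × Additive G) := {m | E.start ∈ E.accept ∧ m = 0} ∪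
    ⋃ q ∈ E.accept, {m | PathLabel E.moveLabels Set.univ E.start q m}
  have hR : IsSemilinearSet R := by
    refine .union (.of_finite ((Set.finite_singleton 0).subset fun m hm => hm.2)) ?_
    exact .biUnion E.accept.toFinite fun q _ =>
      PathLabel.isSemilinearSet E.isSemilinearSet_moveLabels _ _ _
  -- Pulling back along `n ↦ (n, 0)` selects the totals whose register factor is the identity.
  refine ⟨_, hR.preimage (AddMonoidHom.inl ℕ (Additive G)), fun w => ?_⟩
  rw [mem_language_iff_pathLabel]
  simp [R, Prod.ext_iff]

end Unary

/-! ### Relabelling along an injective homomorphism -/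

section MapLabels

variable {G H : Type} [Group G] [Group H] {α σ : Type}

theorem reflTransGen_mapLabels_iff {φ : G →* H} (hφ : Function.Injective φ)
    (E : GroupAutomaton G α σ) {q q' : σ} {w w' : List α} {x x' : G} :
    Relation.ReflTransGen (E.mapLabels φ).Move ⟨q, w, φ x⟩ ⟨q', w', φ x'⟩ ↔
      Relation.ReflTransGen E.Move ⟨q, w, x⟩ ⟨q', w', x'⟩ := by
  let f : Config G α σ → Config H α σ := fun c => ⟨c.state, c.input, φ c.register⟩
  have hf : Function.Injective f := by
    rintro ⟨_, _, _⟩ ⟨_, _, _⟩ h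
    simp only [f, Config.mk.injEq] at h ⊢
    exact ⟨h.1, h.2.1, hφ h.2.2⟩
  constructor
  · intro h
    -- All labels lie in the range of `φ`, so whatever is reachable from an image configuration is
    -- again an image and its computation lifts.
    have key : ∀ c d, Relation.ReflTransGen (E.mapLabels φ).Move (f c) d →
        ∃ e, f e = d ∧ Relation.ReflTransGen E.Move c e := by
      intro c d h
      induction h with
      | refl => exact ⟨c, rfl, .refl⟩
      | tail _ hm ih =>
        obtain ⟨⟨s, v, y⟩, rfl, he⟩ := ih
        cases hm with
        | read _ _ a v _ _ h =>
          obtain ⟨⟨s', m⟩, hm, h⟩ := h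
          cases h
          exact ⟨⟨s', v, y * m⟩, by simp [f], he.tail (.read _ _ _ _ _ _ hm)⟩
        | silent _ _ _ _ _ h =>
          obtain ⟨⟨s', m⟩, hm, h⟩ := h
          cases h
          exact ⟨⟨s', v, y * m⟩, by simp [f], he.tail (.silent _ _ _ _ _ hm)⟩
    obtain ⟨e, he, h⟩ := key ⟨q, w, x⟩ _ h
    rwa [hf (he.trans (rfl : _ = f ⟨q', w', x'⟩))] at h
  · refine fun h => h.lift f fun c d hm => ?_
    cases hm with
    | read _ _ _ _ _ _ h =>
      change (E.mapLabels φ).Move _ ⟨_, _, φ (_ * _)⟩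
      rw [map_mul]
      exact .read (E := E.mapLabels φ) _ _ _ _ _ _ ⟨_, h, rfl⟩
    | silent _ _ _ _ _ h =>
      change (E.mapLabels φ).Move _ ⟨_, _, φ (_ * _)⟩
      rw [map_mul]
      exact .silent (E := E.mapLabels φ) _ _ _ _ _ ⟨_, h, rfl⟩

theorem language_mapLabels {φ : G →* H} (hφ : Function.Injective φ) (E : GroupAutomaton G α σ) :
    (E.mapLabels φ).language = E.language := by
  ext w
  refine exists_congr fun q => and_congr Iff.rfl ?_
  rw [← reflTransGen_mapLabels_iff hφ, map_one]
  rfl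

end MapLabels

end GroupAutomaton

theorem languageClass_mono {G H : Type} [Group G] [Group H] {φ : G →* H}
    (hφ : Function.Injective φ) : languageClass G ⊆ languageClass H := by
  rintro L ⟨σ, hσ, E, hE⟩
  exact ⟨σ, hσ, E.mapLabels φ, (E.language_mapLabels hφ).trans hE⟩

theorem diagHom_injective : Function.Injective diagHom := by
  intro s t h
  have := congrArg (fun A : Matrix.SpecialLinearGroup (Fin 2) ℚ => A 0 0) h
  exact Subtype.ext this

/-! ### From periodic lengths to regularity -/

/-- A language is regular if membership depends only on the length of the word, and the set of
lengths is ultimately periodic. -/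
theorem Language.isRegular_of_isSemilinearSet_length {α : Type*} {L : Language α} {A : Set ℕ}
    (hA : IsSemilinearSet A) (hL : ∀ w, w ∈ L ↔ w.length ∈ A) : L.IsRegular := by
  obtain ⟨k, p, hp, hper⟩ := Nat.isSemilinearSet_iff_ultimately_periodic.1 hA
  refine .of_finite_range_leftQuotient ?_
  let Q : ℕ → Language α := fun n => {y | n + y.length ∈ A}
  -- `Q n` is the left quotient by any word of length `n`; subtracting the period brings `n` below
  -- `k + p`, leaving finitely many quotients.
  have hQ : ∀ n, ∃ m < k + p, Q n = Q m := by
    intro n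
    induction n using Nat.strong_induction_on with
    | _ n ih =>
      by_cases hn : n < k + p
      · exact ⟨n, hn, rfl⟩
      · obtain ⟨m, hm, h⟩ := ih (n - p) (by omega)
        refine ⟨m, hm, h ▸ ?_⟩
        ext y
        have := hper (n - p + y.length) (by omega)
        rw [show n - p + y.length + p = n + y.length by omega] at this
        exact this.symm
  refine ((Set.finite_Iio (k + p)).image Q).subset ?_
  rintro _ ⟨x, rfl⟩
  obtain ⟨m, hm, h⟩ := hQ x.length
  refine ⟨m, hm, h ▸ ?_⟩
  ext y
  rw [Language.mem_leftQuotient, hL, List.length_append]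
  rfl

theorem isRegular_of_mem_languageClass {G : Type} [CommGroup G] {L : FormalLanguage}
    (hL : L ∈ languageClass G) (hc : Nat.card L.alphabet = 1) : L.words.IsRegular := by
  obtain ⟨σ, _, E, hE⟩ := hL
  have := L.finite_alphabet
  have := (Nat.card_eq_one_iff_unique.1 hc).1
  obtain ⟨A, hA, h⟩ := E.exists_isSemilinearSet_length
  exact hE ▸ Language.isRegular_of_isSemilinearSet_length hA h

/-! ### Nonregularity of the odd powers of two -/

/-- The words of `oddPowLanguage`, over the alphabet `Unit`. -/
def oddPowWords : Language Unit := oddPowLanguage.words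

theorem replicate_mem_oddPowWords_iff {n : ℕ} :
    List.replicate n () ∈ oddPowWords ↔ ∃ k : ℕ, n = 2 ^ (2 * k + 1) := by
  refine exists_congr fun k => ⟨fun h => ?_, fun h => h ▸ rfl⟩
  simpa using congrArg List.length h

theorem not_isRegular_oddPowWords : ¬ oddPowWords.IsRegular := by
  intro h
  refine Set.infinite_of_injective_forall_mem (f := fun n : ℕ =>
    oddPowWords.leftQuotient (List.replicate (2 ^ (2 * n + 1)) ())) ?_
    (fun n => Set.mem_range_self _) h.finite_range_leftQuotient
  have key : ∀ n m : ℕ, n < m →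
      oddPowWords.leftQuotient (List.replicate (2 ^ (2 * n + 1)) ()) ≠
        oddPowWords.leftQuotient (List.replicate (2 ^ (2 * m + 1)) ()) := by
    intro n m hnm heq
    -- This suffix completes `2 ^ (2n+1)` to `2 ^ (2n+3)`, but takes the larger `2 ^ (2m+1)`
    -- strictly between the consecutive admissible lengths `2 ^ (2m+1)` and `2 ^ (2m+3)`.
    have hn : List.replicate (3 * 2 ^ (2 * n + 1)) () ∈
        oddPowWords.leftQuotient (List.replicate (2 ^ (2 * n + 1)) ()) := by
      rw [Language.mem_leftQuotient, List.replicate_append_replicate, replicate_mem_oddPowWords_iff]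
      exact ⟨n + 1, by ring⟩
    rw [heq, Language.mem_leftQuotient, List.replicate_append_replicate, replicate_mem_oddPowWords_iff] at hn
    obtain ⟨j, hj⟩ := hn
    have hlt : 2 ^ (2 * n + 1) < 2 ^ (2 * m + 1) := Nat.pow_lt_pow_right one_lt_two (by omega)
    have h₁ : 2 * m + 1 < 2 * j + 1 :=
      (Nat.pow_lt_pow_iff_right one_lt_two).1 (by rw [← hj]; have := Nat.two_pow_pos (2 * n + 1); omega)
    have h₂ : 2 * j + 1 < 2 * m + 1 + 2 :=
      (Nat.pow_lt_pow_iff_right one_lt_two).1 (by rw [← hj, pow_add _ _ 2]; omega)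
    omega
  intro n m heq
  rcases lt_trichotomy n m with h | h | h
  · exact (key n m h heq).elim
  · exact h
  · exact (key m n h heq.symm).elim

/-! ### An `SL(2, ℚ)`-automaton for the odd powers of two -/

section OddPowAutomaton

/-- The matrix `!![1, 1; 0, 1]`, as an element of `SL(2, ℚ)`. -/
def shearSL : Matrix.SpecialLinearGroup (Fin 2) ℚ :=
  ⟨!![1, 1; 0, 1], by simp [Matrix.det_fin_two]⟩

theorem coe_shearSL_pow (n : ℕ) :
    ((shearSL ^ n : Matrix.SpecialLinearGroup (Fin 2) ℚ) : Matrix (Fin 2) (Fin 2) ℚ) =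
      !![1, (n : ℚ); 0, 1] := by
  induction n with
  | zero => ext i j; fin_cases i <;> fin_cases j <;> simp
  | succ n ih =>
    rw [pow_succ, Matrix.SpecialLinearGroup.coe_mul, ih]
    simp [shearSL, add_comm]

/-- The matrix `diag(2, 1/2)`, as an element of `SL(2, ℚ)`. -/
def diagTwo : Matrix.SpecialLinearGroup (Fin 2) ℚ := diagHom ⟨2, two_pos⟩

theorem coe_diagTwo_pow (n : ℕ) :
    ((diagTwo ^ n : Matrix.SpecialLinearGroup (Fin 2) ℚ) : Matrix (Fin 2) (Fin 2) ℚ) =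
      !![2 ^ n, 0; 0, 1 / 2 ^ n] := by
  rw [diagTwo, ← map_pow]
  exact coe_diagSL _

theorem diagTwo_conj_shearSL_eq_one_iff (n k m : ℕ) :
    diagTwo ^ n * shearSL ^ 2 * diagTwo⁻¹ ^ k * shearSL⁻¹ ^ m = 1 ↔
      k = n ∧ m = 2 ^ (2 * n + 1) := by
  have ext_coe (A B : Matrix.SpecialLinearGroup (Fin 2) ℚ) :
      A = B ↔ (A : Matrix (Fin 2) (Fin 2) ℚ) = B := Subtype.ext_iff
  -- Free of inverses, the equation is `diagTwo ^ n * shearSL ^ 2 = shearSL ^ m * diagTwo ^ k`. The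
  -- upper left entries force `k = n`, the upper right ones `m = 2 * 4 ^ n`.
  rw [inv_pow, inv_pow, mul_inv_eq_one, mul_inv_eq_iff_eq_mul, ext_coe,
    Matrix.SpecialLinearGroup.coe_mul, Matrix.SpecialLinearGroup.coe_mul, coe_diagTwo_pow,
    coe_diagTwo_pow, coe_shearSL_pow, coe_shearSL_pow]
  have hn : (2 : ℚ) ^ n ≠ 0 := by positivity
  constructor
  · intro h
    have h₀ := congrFun (congrFun h 0) 0
    have h₁ := congrFun (congrFun h 0) 1
    simp only [Matrix.mul_fin_two, Matrix.of_apply, Matrix.cons_val', Matrix.cons_val_zero,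
      Matrix.cons_val_one, Matrix.cons_val_fin_one] at h₀ h₁
    have hk : n = k := pow_right_injective₀ (a := (2 : ℚ)) (by norm_num) (by norm_num)
      (by simpa using h₀)
    subst hk
    refine ⟨rfl, ?_⟩
    field_simp at h₁
    have : (m : ℚ) = 2 ^ (2 * n + 1) := by
      rw [pow_succ, pow_mul', sq]
      push_cast at h₁
      linear_combination -h₁
    exact_mod_cast this
  · rintro ⟨rfl, rfl⟩
    rw [Matrix.mul_fin_two, Matrix.mul_fin_two]
    have : (2 : ℚ) ^ k * 2 = 2 ^ (2 * k + 1) * (1 / 2 ^ k) := by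
      field_simp
      ring
    simp [this]

/-- The automaton that guesses `n`, moves to the register content `diagTwo ^ n * shearSL ^ 2 *
diagTwo⁻¹ ^ n`, and then multiplies by `shearSL⁻¹` for each letter read. -/
def oddPowAutomaton : GroupAutomaton (Matrix.SpecialLinearGroup (Fin 2) ℚ) Unit (Fin 3) where
  step
    | 0, none => {(0, diagTwo), (1, shearSL ^ 2)}
    | 1, none => {(1, diagTwo⁻¹), (2, 1)}
    | 2, some _ => {(2, shearSL⁻¹)}
    | _, _ => ∅
  finite_step q a := by fin_cases q <;> cases a <;> simp
  start := 0
  accept := {2}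

/-- The configurations that `oddPowAutomaton` can reach from its initial one on the input `w`. -/
def OddPowReachable (w : List Unit)
    (c : GroupAutomaton.Config (Matrix.SpecialLinearGroup (Fin 2) ℚ) Unit (Fin 3)) : Prop :=
  (c.state = 0 ∧ c.input = w ∧ ∃ n, c.register = diagTwo ^ n) ∨
  (c.state = 1 ∧ c.input = w ∧ ∃ n k, c.register = diagTwo ^ n * shearSL ^ 2 * diagTwo⁻¹ ^ k) ∨
  (c.state = 2 ∧ ∃ n k m, w.length = m + c.input.length ∧
    c.register = diagTwo ^ n * shearSL ^ 2 * diagTwo⁻¹ ^ k * shearSL⁻¹ ^ m)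

theorem OddPowReachable.move {w : List Unit}
    {c d : GroupAutomaton.Config (Matrix.SpecialLinearGroup (Fin 2) ℚ) Unit (Fin 3)}
    (hc : OddPowReachable w c) (h : oddPowAutomaton.Move c d) : OddPowReachable w d := by
  cases h with
  | read q q' a v x m h =>
    rcases hc with ⟨hq, -⟩ | ⟨hq, -⟩ | ⟨hq, n, k, l, hl, hr⟩ <;> dsimp only at hq <;> subst hq
    · exact h.elim
    · exact h.elim
    · cases h
      dsimp only at hl hr
      refine .inr (.inr ⟨rfl, n, k, l + 1, ?_, ?_⟩)
      · rw [hl, List.length_cons]; dsimp only; omega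
      · rw [pow_succ _ l, ← mul_assoc, ← hr]
  | silent q q' v x m h =>
    rcases hc with ⟨hq, hv, n, hr⟩ | ⟨hq, hv, n, k, hr⟩ | ⟨hq, -⟩ <;> dsimp only at hq <;> subst hq
    · rcases h with h | h <;> cases h
      · exact .inl ⟨rfl, hv, n + 1, by rw [pow_succ, ← hr]⟩
      · exact .inr (.inl ⟨rfl, hv, n, 0, by rw [pow_zero, mul_one, ← hr]⟩)
    · rcases h with h | h <;> cases h
      · exact .inr (.inl ⟨rfl, hv, n, k + 1, by rw [pow_succ _ k, ← mul_assoc, ← hr]⟩)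
      · exact .inr (.inr ⟨rfl, n, k, 0, by dsimp only at hv ⊢; rw [hv, zero_add],
          by rw [pow_zero, mul_one, mul_one, ← hr]⟩)
    · exact h.elim

/-- The loops in states `0` and `1` run independently, so `n` and `k` are arbitrary here; only the
final identity test forces them to agree. -/
theorem oddPowAutomaton_reaches (w : List Unit) (n k : ℕ) :
    Relation.ReflTransGen oddPowAutomaton.Move ⟨0, w, 1⟩
      ⟨2, [], diagTwo ^ n * shearSL ^ 2 * diagTwo⁻¹ ^ k * shearSL⁻¹ ^ w.length⟩ := by
  have h₀ : Relation.ReflTransGen oddPowAutomaton.Move ⟨0, w, 1⟩ ⟨0, w, diagTwo ^ n⟩ := by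
    induction n with
    | zero => exact .refl
    | succ n ih => rw [pow_succ]; exact ih.tail (.silent _ _ _ _ _ (.inl rfl))
  have h₁ : Relation.ReflTransGen oddPowAutomaton.Move ⟨0, w, 1⟩
      ⟨1, w, diagTwo ^ n * shearSL ^ 2 * diagTwo⁻¹ ^ k⟩ := by
    induction k with
    | zero => rw [pow_zero, mul_one]; exact h₀.tail (.silent _ _ _ _ _ (.inr rfl))
    | succ k ih =>
      rw [pow_succ _ k, ← mul_assoc]
      exact ih.tail (.silent _ _ _ _ _ (.inl rfl))
  have h₂ : ∀ (v : List Unit) (x : Matrix.SpecialLinearGroup (Fin 2) ℚ),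
      Relation.ReflTransGen oddPowAutomaton.Move ⟨2, v, x⟩
        ⟨2, [], x * shearSL⁻¹ ^ v.length⟩ := by
    intro v
    induction v with
    | nil => intro x; rw [List.length_nil, pow_zero, mul_one]
    | cons a v ih =>
      intro x
      rw [List.length_cons, pow_succ', ← mul_assoc]
      exact .head (.read _ _ _ _ _ _ rfl) (ih _)
  refine (h₁.tail (.silent _ 2 _ _ 1 (.inr rfl))).trans ?_
  rw [mul_one]
  exact h₂ _ _

theorem language_oddPowAutomaton : oddPowAutomaton.language = oddPowWords := by
  ext w
  obtain ⟨l, rfl⟩ : ∃ l, w = List.replicate l () :=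
    ⟨w.length, List.eq_replicate_of_mem fun _ _ => rfl⟩
  rw [replicate_mem_oddPowWords_iff]
  constructor
  · rintro ⟨q, rfl, h⟩
    have : OddPowReachable (List.replicate l ()) ⟨2, [], 1⟩ := by
      refine h.rec (motive := fun c _ => OddPowReachable _ c) ?_ fun _ hm ih => ih.move hm
      exact .inl ⟨rfl, rfl, 0, rfl⟩
    obtain ⟨h, -⟩ | ⟨h, -⟩ | ⟨-, n, k, m, hl, hr⟩ := this
    · cases h
    · cases h
    · obtain rfl : l = m := by simpa using hl
      exact ⟨n, ((diagTwo_conj_shearSL_eq_one_iff n k l).1 hr.symm).2⟩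
  · rintro ⟨n, hn⟩
    refine ⟨2, rfl, ?_⟩
    have := oddPowAutomaton_reaches (List.replicate l ()) n n
    rwa [List.length_replicate, (diagTwo_conj_shearSL_eq_one_iff n n l).2 ⟨rfl, hn⟩] at this

theorem oddPowLanguage_mem_languageClass :
    oddPowLanguage ∈ languageClass (Matrix.SpecialLinearGroup (Fin 2) ℚ) :=
  ⟨Fin 3, inferInstance, oddPowAutomaton, language_oddPowAutomaton⟩

end OddPowAutomaton

theorem mainTheorem8 :
    -- the class of languages of `ℚ⁺`-automata is a proper subclass of that of `SL(2, ℚ)`-automata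
    languageClass PosRat ⊂ languageClass (Matrix.SpecialLinearGroup (Fin 2) ℚ) ∧
    -- the inclusion is realized by the embedding `s ↦ diag(s, 1/s)`
    (Function.Injective diagHom ∧
      ∀ (α σ : Type) (_ : Finite α) (_ : Finite σ) (E : GroupAutomaton PosRat α σ),
        (E.mapLabels diagHom).language = E.language) ∧
    -- unary languages of `ℚ⁺`-automata are regular
    (∀ L ∈ languageClass PosRat, Nat.card L.alphabet = 1 → L.words.IsRegular) ∧
    -- a unary nonregular language of an `SL(2, ℚ)`-automaton
    (oddPowLanguage ∈ languageClass (Matrix.SpecialLinearGroup (Fin 2) ℚ) ∧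
      ¬ oddPowLanguage.words.IsRegular) := by
  refine ⟨⟨languageClass_mono diagHom_injective, fun h => ?_⟩,
    ⟨diagHom_injective, fun _ _ _ _ E => E.language_mapLabels diagHom_injective⟩,
    fun L hL hc => isRegular_of_mem_languageClass hL hc,
    oddPowLanguage_mem_languageClass, not_isRegular_oddPowWords⟩
  exact not_isRegular_oddPowWords
    (isRegular_of_mem_languageClass (h oddPowLanguage_mem_languageClass)
      (Nat.card_eq_one_iff_unique.2 ⟨inferInstanceAs (Subsingleton Unit),
        inferInstanceAs (Nonempty Unit)⟩))
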